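/- Let $p\in\mathbb{C}$ with $0<|p|<1$, let $\nu\in\mathbb{C}$, let $p^s=e^{s\operatorname{Log}p}$ (principal logarithm), and assume $p^{2\nu}\notin p^{\mathbb{Z}}$. Put $(a;p)_n=\prod_{k=0}^{n-1}(1-ap^k)$, $(a;p)_\infty=\prod_{k\ge 0}(1-ap^k)$, $(a,b;p)_\infty=(a;p)_\infty(b;p)_\infty$, $$\theta_p(x)=\sum_{n\in\mathbb{Z}}p^{n(n-1)/2}x^n,\qquad {}_1\varphi_1(0;b;p,x)=\sum_{n\ge 0}\frac{(-1)^np^{n(n-1)/2}}{(b;p)_n(p;p)_n}x^n,\qquad [\lambda;p]=\{\lambda p^k: k\in\mathbb{Z}\}.$$ Consider the Hahn--Exton $q$-Bessel equation, written in the variable $t=1/x$ at infinity, $$z(p^2t)-\Bigl\{(p^\nu+p^{-\nu})-\frac{p^{-2-\nu}}{t}\Bigr\}z(pt)+z(t)=0 .$$ There is exactly one sequence $(a_n)_{n\ge0}$ with $a_0=1$ such that $\sum_{n\ge0}a_nt^n$ converges on some disc $|t|<r$, $r>0$, and $$z(t)=\frac{1}{\theta_p(-p^{\nu+2}t)}\sum_{n\ge0}a_nt^n$$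 satisfies this equation for all $t$ with $0<|t|<r$ and $1/t\notin[p^{\nu+2};p]$. For this sequence the series $\sum_{n\ge0}a_nt^n$ converges for every $t\in\mathbb{C}$, and for every $x\in\mathbb{C}^*\setminus[p^{\nu+2};p]$, $$z\left(\frac1x\right)=\frac{1}{(p^{-2\nu},p;p)_\infty}\,\frac{\theta_p\left(-\frac{p^{2\nu+2}}{x}\right)}{\theta_p\left(-\frac{p^{\nu+2}}{x}\right)}\;{}_1\varphi_1\left(0;p^{1+2\nu};p,x\right)+\frac{1}{(p^{2\nu},p;p)_\infty}\,\frac{\theta_p\left(-\frac{p^{2}}{x}\right)}{\theta_p\left(-\frac{p^{\nu+2}}{x}\right)}\;{}_1\varphi_1\left(0;p^{1-2\nu};p,p^{-2\nu}x\right).$$ -/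

import Mathlib

noncomputable section

namespace HahnExton

/-- The finite `q`-shifted factorial `(a;q)_n = (1-a)(1-aq)⋯(1-aq^{n-1})`. -/
def qPoch (a q : ℂ) (n : ℕ) : ℂ := ∏ k ∈ Finset.range n, (1 - a * q ^ k)

/-- The infinite `q`-shifted factorial `(a;q)_∞`, an absolutely convergent product for `|q| < 1`. -/
def qPochInf (a q : ℂ) : ℂ := ∏' k : ℕ, (1 - a * q ^ k)

/-- The basic hypergeometric series `_rφ_s(a₁,…,a_r; b₁,…,b_s; q, x)`. -/
def basicHyp (as bs : List ℂ) (q x : ℂ) : ℂ :=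
  ∑' n : ℕ, (as.map fun a => qPoch a q n).prod /
      ((bs.map fun b => qPoch b q n).prod * qPoch q q n) *
    ((-1) ^ n * q ^ (n * (n - 1) / 2)) ^ (1 + (bs.length : ℤ) - (as.length : ℤ)) * x ^ n

/-- The theta function of Jacobi, `θ_q(x) = ∑_{n ∈ ℤ} q^{n(n-1)/2} x^n`
(the division in the exponent is exact). -/
def theta (q x : ℂ) : ℂ := ∑' n : ℤ, q ^ (n * (n - 1) / 2) * x ^ n

/-- The `q`-spiral `[c;q] = c q^ℤ`. -/
def qSpiral (c q : ℂ) : Set ℂ := {x | ∃ k : ℤ, x = c * q ^ k}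

/-- The function `z(t) = θ_p(-p^{ν+2} t)⁻¹ ∑_{n ≥ 0} a_n t^n`. -/
def zFun (p ν : ℂ) (a : ℕ → ℂ) (t : ℂ) : ℂ :=
  (theta p (-(p ^ (ν + 2) * t)))⁻¹ * ∑' n : ℕ, a n * t ^ n

/-- The Hahn–Exton equation in the variable `t = 1/x` at infinity, at the point `t`:
`z(p²t) - {(p^ν + p^{-ν}) - p^{-2-ν}/t} z(pt) + z(t) = 0`. -/
def HahnExtonEqAt (p ν : ℂ) (z : ℂ → ℂ) (t : ℂ) : Prop :=
  z (p ^ 2 * t) - ((p ^ ν + p ^ (-ν)) - p ^ (-2 - ν) / t) * z (p * t) + z t = 0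

/-- `a` is the coefficient sequence of a solution at infinity: `a_0 = 1`, and on some disc
`|t| < r` the series `∑ a_n t^n` converges and `z(t) = θ_p(-p^{ν+2} t)⁻¹ ∑ a_n t^n` satisfies the
Hahn–Exton equation at every `t ≠ 0` that is not a pole of the prefactor. -/
def IsSolutionAtInfinity (p ν : ℂ) (a : ℕ → ℂ) : Prop :=
  a 0 = 1 ∧ ∃ r : ℝ, 0 < r ∧
    (∀ t : ℂ, ‖t‖ < r → Summable fun n : ℕ => a n * t ^ n) ∧
    ∀ t : ℂ, t ≠ 0 → ‖t‖ < r → 1 / t ∉ qSpiral (p ^ (ν + 2)) p →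
      HahnExtonEqAt p ν (zFun p ν a) t

end HahnExton

end

/-!
Write `z(t) = f(t) / θ_p(-p^{ν+2} t)`. The equation becomes a `p`-difference equation for `f` with
polynomial coefficients, that is, a recurrence that determines the Taylor coefficients `a_n` of `f`
from `a_0`. Its solution has the form `a_n = p^{n(n-1)/2} (-p²)^n c_n`, where `c_n` satisfies the
recurrence of the Rogers–Szegő polynomials divided by `(p;p)_n`. That recurrence also makes sense
for negative `n`, and Jackson's second `q`-Bessel functions of orders `2ν` and `-2ν`, evaluated on a
geometric grid, give two solutions on all of `ℤ`. The combination of these with `c_{-1} = 0` and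
`c_0 = 1` then vanishes at all negative `n`; its coefficients come from the evaluation
`₀φ₁(; b; p, b) = 1 / (b;p)_∞` and from the Casoratian of the two solutions. Finally
`∑_{n ∈ ℤ} p^{n(n-1)/2} s^n ₀φ₁(; b; p, -s x p^n) = θ_p(s) ₁φ₁(0; b; p, x)`, by expanding `₀φ₁` and
shifting `n`, turns each of the two parts of `∑ a_n t^n` into a theta function times a `₁φ₁`.
-/

noncomputable section

namespace HahnExton

open Filter Topology Finset

section Series

lemma summable_norm_of_succ_eq_mul {R : Type*} [SeminormedRing R] {f g : ℕ → R} {a : R}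
    (ha : ‖a‖ < 1) (hg : Tendsto g atTop (𝓝 a)) (h : ∀ n, f (n + 1) = f n * g n) :
    Summable fun n => ‖f n‖ := by
  obtain ⟨r, har, hr⟩ := exists_between ha
  refine summable_of_ratio_norm_eventually_le hr ?_
  filter_upwards [hg.norm.eventually_le_const har] with n hn
  rw [norm_norm, norm_norm, h, mul_comm r]
  exact (norm_mul_le _ _).trans (by gcongr)

lemma hasSum_mul_of_summable_norm {R ι κ : Type*} [NormedRing R] [CompleteSpace R] {f : ι → R}
    {g : κ → R} {s t : R} (hf : HasSum f s) (hg : HasSum g t) (hf' : Summable fun i => ‖f i‖)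
    (hg' : Summable fun j => ‖g j‖) : HasSum (fun i : ι × κ => f i.1 * g i.2) (s * t) :=
  hf.mul hg (summable_mul_of_summable_norm hf' hg')

lemma hasSum_natCast_iff_of_neg_eq_zero {α : Type*} [AddCommMonoid α] [TopologicalSpace α]
    {f : ℤ → α} {s : α} (hf : ∀ n < 0, f n = 0) : HasSum (fun n : ℕ => f n) s ↔ HasSum f s :=
  Nat.cast_injective.hasSum_iff fun n hn => hf n <| by
    by_contra! h
    exact hn ⟨n.toNat, Int.toNat_of_nonneg h⟩

variable {𝕜 : Type*} [NontriviallyNormedField 𝕜] {b : ℕ → 𝕜} {F : 𝕜 → 𝕜}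

lemma hasFPowerSeriesAt_ofScalars_of_hasSum
    (hF : ∀ᶠ t in 𝓝 0, HasSum (fun n => b n * t ^ n) (F t)) :
    HasFPowerSeriesAt F (FormalMultilinearSeries.ofScalars 𝕜 b) 0 := by
  rw [hasFPowerSeriesAt_iff]
  filter_upwards [hF] with t ht
  simpa only [FormalMultilinearSeries.coeff_ofScalars, smul_eq_mul, zero_add, mul_comm] using ht

lemma coeff_eq_zero_of_frequently_eq_zero
    (hF : ∀ᶠ t in 𝓝[≠] 0, HasSum (fun n => b n * t ^ n) (F t))
    (hF0 : ∃ᶠ t in 𝓝[≠] 0, F t = 0) : b = 0 := by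
  classical
  have hsum : ∀ᶠ t in 𝓝 0, HasSum (fun n => b n * t ^ n) (Function.update F 0 (b 0) t) := by
    filter_upwards [eventually_nhdsWithin_iff.1 hF] with t ht
    rcases eq_or_ne t 0 with rfl | ht0
    · simpa using hasSum_single (f := fun n => b n * 0 ^ n) 0 fun n hn => by simp [hn]
    · simpa only [Function.update_of_ne ht0] using ht ht0
  have hzero : ∃ᶠ t in 𝓝[≠] 0, Function.update F 0 (b 0) t = 0 :=
    hF0.mp <| eventually_mem_nhdsWithin.mono fun t ht h => by
      rwa [Function.update_of_ne ht]
  have hs := hasFPowerSeriesAt_ofScalars_of_hasSum hsum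
  have h := hs.eq_zero_of_eventually (hs.analyticAt.frequently_zero_iff_eventually_zero.1 hzero)
  exact (FormalMultilinearSeries.ofScalars_series_eq_zero 𝕜).1 h

end Series

section QPochhammer

variable {a q : ℂ}

lemma qPoch_zero (a q : ℂ) : qPoch a q 0 = 1 := prod_range_zero _

lemma qPoch_succ (a q : ℂ) (n : ℕ) : qPoch a q (n + 1) = qPoch a q n * (1 - a * q ^ n) :=
  prod_range_succ _ _

lemma qPoch_zero_left (q : ℂ) (n : ℕ) : qPoch 0 q n = 1 := by simp [qPoch]

lemma qPoch_ne_zero (h : ∀ k : ℕ, a * q ^ k ≠ 1) (n : ℕ) : qPoch a q n ≠ 0 :=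
  prod_ne_zero_iff.2 fun k _ => sub_ne_zero.2 (h k).symm

lemma self_mul_pow_ne_one (hq : ‖q‖ < 1) (k : ℕ) : q * q ^ k ≠ 1 := by
  rw [← pow_succ']
  intro h
  refine (pow_lt_one₀ (norm_nonneg q) hq k.succ_ne_zero).ne ?_
  rw [← norm_pow, h, norm_one]

lemma summable_norm_neg_mul_pow (a : ℂ) (hq : ‖q‖ < 1) :
    Summable fun k : ℕ => ‖-(a * q ^ k)‖ := by
  simp only [norm_neg, norm_mul, norm_pow]
  exact (summable_geometric_of_lt_one (norm_nonneg _) hq).mul_left _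

lemma multipliable_one_sub_mul_pow (a : ℂ) (hq : ‖q‖ < 1) :
    Multipliable fun k : ℕ => 1 - a * q ^ k := by
  simpa only [sub_eq_add_neg] using
    multipliable_one_add_of_summable (summable_norm_neg_mul_pow a hq)

lemma tendsto_qPoch (a : ℂ) (hq : ‖q‖ < 1) : Tendsto (qPoch a q) atTop (𝓝 (qPochInf a q)) :=
  (multipliable_one_sub_mul_pow a hq).hasProd.tendsto_prod_nat

lemma qPochInf_ne_zero (hq : ‖q‖ < 1) (h : ∀ k : ℕ, a * q ^ k ≠ 1) : qPochInf a q ≠ 0 := by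
  simpa only [qPochInf, sub_eq_add_neg] using tprod_one_add_ne_zero_of_summable
    (fun k => by simpa only [← sub_eq_add_neg] using sub_ne_zero.2 (h k).symm)
    (summable_norm_neg_mul_pow a hq)

lemma qPochInf_eq_one_sub_mul (a : ℂ) (hq : ‖q‖ < 1) :
    qPochInf a q = (1 - a) * qPochInf (q * a) q := by
  have hshift (k : ℕ) : 1 - q * a * q ^ k = 1 - a * q ^ (k + 1) := by ring
  simp only [qPochInf, hshift]
  rw [tprod_eq_zero_mul', pow_zero, mul_one]
  simpa only [hshift] using multipliable_one_sub_mul_pow (q * a) hq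

end QPochhammer

section BasicHyp

variable {as bs : List ℂ} {b q : ℂ}

/-- The coefficient of `x ^ n` in the series `basicHyp as bs q x`. -/
def basicHypCoeff (as bs : List ℂ) (q : ℂ) (n : ℕ) : ℂ :=
  (as.map fun a => qPoch a q n).prod / ((bs.map fun b => qPoch b q n).prod * qPoch q q n) *
    ((-1) ^ n * q ^ (n * (n - 1) / 2)) ^ (1 + (bs.length : ℤ) - (as.length : ℤ))

lemma basicHypCoeff_zero (as bs : List ℂ) (q : ℂ) : basicHypCoeff as bs q 0 = 1 := by
  simp [basicHypCoeff, qPoch_zero]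

lemma basicHypCoeff_succ (as bs : List ℂ) (q : ℂ) (n : ℕ) :
    basicHypCoeff as bs q (n + 1) = basicHypCoeff as bs q n *
      ((as.map fun a => 1 - a * q ^ n).prod /
        ((bs.map fun b => 1 - b * q ^ n).prod * (1 - q * q ^ n)) *
        (-q ^ n) ^ (1 + (bs.length : ℤ) - (as.length : ℤ))) := by
  have hsign : (-1) ^ (n + 1) * q ^ ((n + 1) * (n + 1 - 1) / 2) =
      (-1) ^ n * q ^ (n * (n - 1) / 2) * -q ^ n := by
    rw [Nat.triangle_succ]
    ring
  simp only [basicHypCoeff, qPoch_succ, List.prod_map_mul, hsign, mul_zpow _ (-q ^ n)]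
  simp only [div_eq_mul_inv, mul_inv]
  ring

lemma summable_norm_basicHyp (hlen : as.length ≤ bs.length) (hq : ‖q‖ < 1) (x : ℂ) :
    Summable fun n : ℕ => ‖basicHypCoeff as bs q n * x ^ n‖ := by
  obtain ⟨d, hd⟩ := Nat.exists_eq_add_of_le hlen
  have hexp : 1 + (bs.length : ℤ) - (as.length : ℤ) = (d + 1 : ℕ) := by
    rw [hd]; push_cast; ring
  have hpow : Tendsto (fun n : ℕ => q ^ n) atTop (𝓝 0) :=
    tendsto_pow_atTop_nhds_zero_of_norm_lt_one hq
  have hfactor (c : ℂ) : Tendsto (fun n : ℕ => 1 - c * q ^ n) atTop (𝓝 1) := by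
    simpa only [mul_zero, sub_zero] using tendsto_const_nhds.sub (hpow.const_mul c)
  have hprod (l : List ℂ) :
      Tendsto (fun n : ℕ => (l.map fun c => 1 - c * q ^ n).prod) atTop (𝓝 1) := by
    simpa using tendsto_list_prod l fun c _ => hfactor c
  have hratio := ((((hprod as).div ((hprod bs).mul (hfactor q)) (by simp)).mul
    (hpow.neg.pow (d + 1))).mul_const x)
  refine summable_norm_of_succ_eq_mul (by simp) hratio fun n => ?_
  rw [basicHypCoeff_succ, hexp, zpow_natCast]
  simp only [Pi.div_apply]
  ring

lemma hasSum_basicHyp (hlen : as.length ≤ bs.length) (hq : ‖q‖ < 1) (x : ℂ) :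
    HasSum (fun n : ℕ => basicHypCoeff as bs q n * x ^ n) (basicHyp as bs q x) :=
  (summable_norm_basicHyp hlen hq x).of_norm.hasSum

lemma tendsto_basicHyp_nhds_zero (hlen : as.length ≤ bs.length) (hq : ‖q‖ < 1) :
    Tendsto (basicHyp as bs q) (𝓝 0) (𝓝 1) := by
  have hs := hasFPowerSeriesAt_ofScalars_of_hasSum
    (.of_forall fun x => hasSum_basicHyp hlen hq x)
  have h0 : basicHyp as bs q 0 = 1 := by
    rw [← hs.coeff_zero ![]]
    simp [basicHypCoeff_zero]
  simpa only [h0] using hs.continuousAt.tendsto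

lemma basicHypCoeff_zero_cons (hq0 : q ≠ 0) (as bs : List ℂ) (n : ℕ) :
    basicHypCoeff as bs q n =
      basicHypCoeff (0 :: as) bs q n * ((-1) ^ n * q ^ (n * (n - 1) / 2)) := by
  have hweight : (-1 : ℂ) ^ n * q ^ (n * (n - 1) / 2) ≠ 0 := by simp [hq0]
  simp only [basicHypCoeff, List.map_cons, List.prod_cons, qPoch_zero_left, one_mul,
    List.length_cons, mul_assoc _ _ ((-1) ^ n * q ^ (n * (n - 1) / 2)),
    ← zpow_add_one₀ hweight]
  congr 2
  push_cast
  ring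

lemma basicHypCoeff_zero_one_succ (hq : ‖q‖ < 1) {n : ℕ} (hb : b * q ^ n ≠ 1) :
    basicHypCoeff [] [b] q (n + 1) * ((1 - b * q ^ n) * (1 - q * q ^ n)) =
      basicHypCoeff [] [b] q n * (q ^ n) ^ 2 := by
  have hb' : 1 - b * q ^ n ≠ 0 := sub_ne_zero.2 hb.symm
  have hq' : 1 - q * q ^ n ≠ 0 := sub_ne_zero.2 (self_mul_pow_ne_one hq n).symm
  have hexp : 1 + (([b] : List ℂ).length : ℤ) - (([] : List ℂ).length : ℤ) = (2 : ℕ) := rfl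
  rw [basicHypCoeff_succ, hexp, zpow_natCast, neg_sq]
  simp only [List.map_nil, List.map_cons, List.prod_nil, List.prod_cons, mul_one]
  rw [one_div_mul_eq_div, mul_assoc, div_mul_cancel₀ _ (mul_ne_zero hb' hq')]

lemma basicHyp_zero_one_qDifference (hq : ‖q‖ < 1) (hb : ∀ k : ℕ, b * q ^ k ≠ 1) (x : ℂ) :
    (b - q * x) * basicHyp [] [b] q (q ^ 2 * x) =
      (q + b) * basicHyp [] [b] q (q * x) - q * basicHyp [] [b] q x := by
  have hsum := hasSum_basicHyp (as := []) (bs := [b]) (Nat.zero_le _) hq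
  have h := (((hsum (q ^ 2 * x)).mul_left b).sub ((hsum (q * x)).mul_left (q + b))).add
    ((hsum x).mul_left q)
  rw [← hasSum_nat_add_iff' 1] at h
  have h' := h.unique (((hsum (q ^ 2 * x)).mul_left (q * x)).congr_fun fun n => ?_)
  · simp only [range_one, sum_singleton, pow_zero, basicHypCoeff_zero] at h'
    linear_combination h'
  · have hc := basicHypCoeff_zero_one_succ hq (hb n)
    simp only [mul_pow, pow_succ]
    linear_combination (q * x ^ n * x) * hc

/-- The `n`-th term of the expansion of `1 / (b;q)_∞` according to the size `n × (n + m - 1)` of the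
Durfee rectangle of a partition; it is `q ^ (n (n - 1) + m n) b ^ n / ((b;q)_{m+n} (q;q)_n)`. -/
def durfeeTerm (b q : ℂ) (m n : ℕ) : ℂ :=
  basicHypCoeff [] [0] q n * b ^ n * (q ^ n) ^ m / qPoch b q (m + n)

lemma durfeeTerm_succ (hq : ‖q‖ < 1) (hb : ∀ k : ℕ, b * q ^ k ≠ 1) (m n : ℕ) :
    durfeeTerm b q (m + 1) n =
      q ^ n * durfeeTerm b q m n + (1 - q ^ (n + 1)) * durfeeTerm b q m (n + 1) := by
  have hcoeff := basicHypCoeff_zero_one_succ (b := 0) hq (n := n) (by simp)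
  have hpoch := qPoch_ne_zero hb (m + n)
  have hfactor : 1 - b * q ^ (m + n) ≠ 0 := sub_ne_zero.2 (hb _).symm
  simp only [durfeeTerm, ← add_assoc, add_right_comm m 1 n, qPoch_succ]
  field_simp
  linear_combination (-b ^ (n + 1) * (q ^ n) ^ m * q ^ m) * hcoeff

lemma hasSum_durfeeTerm (hq : ‖q‖ < 1) (hb : ∀ k : ℕ, b * q ^ k ≠ 1) (m : ℕ) :
    HasSum (durfeeTerm b q m) (basicHyp [] [b] q b) := by
  induction m with
  | zero =>
    refine (hasSum_basicHyp (Nat.zero_le _) hq b).congr_fun fun n => ?_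
    simp only [durfeeTerm, basicHypCoeff, List.map_nil, List.map_cons, List.prod_nil,
      List.prod_cons, List.length_cons, qPoch_zero_left, zero_add, pow_zero, mul_one, one_mul,
      div_eq_mul_inv, mul_inv]
    ring
  | succ m ih =>
    have hpow : Summable fun n => q ^ n * durfeeTerm b q m n :=
      ih.summable.norm.of_norm_bounded fun n => by
        rw [norm_mul, norm_pow]
        exact mul_le_of_le_one_left (norm_nonneg _) (pow_le_one₀ (norm_nonneg q) hq.le)
    have hshift := (hasSum_nat_add_iff' 1).2 (ih.sub hpow.hasSum)
    have h := hpow.hasSum.add hshift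
    simp only [range_one, sum_singleton, pow_zero, one_mul, sub_self, sub_zero,
      add_sub_cancel] at h
    refine h.congr_fun fun n => ?_
    rw [durfeeTerm_succ hq hb]
    ring

lemma basicHyp_zero_one_self (hq : ‖q‖ < 1) (hb : ∀ k : ℕ, b * q ^ k ≠ 1) :
    basicHyp [] [b] q b = 1 / qPochInf b q := by
  have hinv : Tendsto (fun n => 1 / qPoch b q n) atTop (𝓝 (1 / qPochInf b q)) :=
    tendsto_const_nhds.div (tendsto_qPoch b hq) (qPochInf_ne_zero hq hb)
  obtain ⟨C, hC⟩ := (Metric.isBounded_range_of_tendsto _ hinv).exists_norm_le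
  have hterm (m n : ℕ) : durfeeTerm b q m n =
      basicHypCoeff [] [0] q n * b ^ n * ((q ^ n) ^ m * (1 / qPoch b q (m + n))) := by
    rw [durfeeTerm]
    ring
  have hlim (n : ℕ) : Tendsto (fun m => durfeeTerm b q m n) atTop
      (𝓝 (if n = 0 then 1 / qPochInf b q else 0)) := by
    have hinv' := (tendsto_add_atTop_iff_nat n).2 hinv
    simp only [hterm]
    split_ifs with hn
    · simpa [hn, basicHypCoeff_zero] using hinv
    · have hpow : Tendsto (fun m => (q ^ n) ^ m) atTop (𝓝 0) :=
        tendsto_pow_atTop_nhds_zero_of_norm_lt_one <| by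
          rw [norm_pow]
          exact pow_lt_one₀ (norm_nonneg q) hq hn
      simpa using (hpow.mul hinv').const_mul (basicHypCoeff [] [0] q n * b ^ n)
  have hbound (m n : ℕ) :
      ‖durfeeTerm b q m n‖ ≤ ‖basicHypCoeff [] [0] q n * b ^ n‖ * (1 * C) := by
    rw [hterm, norm_mul, norm_mul ((q ^ n) ^ m), ← pow_mul, norm_pow]
    gcongr
    · exact pow_le_one₀ (norm_nonneg q) hq.le
    · exact hC _ ⟨m + n, rfl⟩
  have h := tendsto_tsum_of_dominated_convergence
    ((summable_norm_basicHyp (Nat.zero_le _) hq b).mul_right (1 * C)) hlim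
    (.of_forall hbound)
  simp only [(hasSum_durfeeTerm hq hb _).tsum_eq, tsum_ite_eq] at h
  exact tendsto_nhds_unique tendsto_const_nhds h

end BasicHyp

section RogersSzego

variable {q z : ℂ} {c d : ℤ → ℂ}

/-- The three-term recurrence satisfied by `c n = H_n(z) / (q;q)_n`, where `H_n` are the
Rogers–Szegő polynomials, extended to all integer indices. -/
def IsRogersSzego (q z : ℂ) (c : ℤ → ℂ) : Prop :=
  ∀ n, (1 - q ^ (n + 2)) * c (n + 2) = (1 + z) * c (n + 1) - z * c n

lemma IsRogersSzego.const_mul_add_const_mul (hc : IsRogersSzego q z c) (hd : IsRogersSzego q z d)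
    (A B : ℂ) : IsRogersSzego q z fun n => A * c n + B * d n :=
  fun n => by linear_combination A * hc n + B * hd n

lemma IsRogersSzego.eq_zero_of_neg (hc : IsRogersSzego q z c) (hz0 : z ≠ 0) (h : c (-1) = 0)
    {n : ℤ} (hn : n < 0) : c n = 0 := by
  have hstep (m : ℕ) : c (-m - 1) = 0 ∧ (1 - q ^ (-m : ℤ)) * c (-m) = 0 := by
    induction m with
    | zero => simp [h]
    | succ m ih =>
      have hrec := hc (-m - 2)
      rw [show (-m - 2 + 2 : ℤ) = -m by ring, show (-m - 2 + 1 : ℤ) = -m - 1 by ring, ih.1,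
        ih.2] at hrec
      have hm : c (-m - 2) = 0 := by simpa [hz0] using hrec
      push_cast
      rw [show (-(m + 1) - 1 : ℤ) = -m - 2 by ring, show (-(m + 1) : ℤ) = -m - 1 by ring]
      simp [hm, ih.1]
  have h := (hstep (-n - 1).toNat).1
  rwa [Int.toNat_of_nonneg (by lia), show -(-n - 1) - 1 = n by ring] at h

/-- Jackson's second `q`-Bessel function `J_ν^{(2)}` on a geometric grid, without its elementary
prefactor and with `z = q ^ ν`. -/
def jacksonSeq (q z : ℂ) (n : ℤ) : ℂ := basicHyp [] [q * z] q (q ^ (n + 2) * z)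

lemma jacksonSeq_recurrence (hq0 : q ≠ 0) (hq : ‖q‖ < 1) (hz : ∀ k : ℕ, q * z * q ^ k ≠ 1)
    (n : ℤ) : z * ((1 - q ^ (n + 2)) * jacksonSeq q z (n + 2)) =
      (1 + z) * jacksonSeq q z (n + 1) - jacksonSeq q z n := by
  have h := basicHyp_zero_one_qDifference hq hz (q ^ (n + 2) * z)
  have hsq : q ^ 2 * (q ^ (n + 2) * z) = q ^ (n + 2 + 2) * z := by
    rw [zpow_add₀ hq0 (n + 2), zpow_ofNat]
    ring
  have hone : q * (q ^ (n + 2) * z) = q ^ (n + 1 + 2) * z := by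
    rw [add_right_comm, zpow_add_one₀ hq0 (n + 2)]
    ring
  rw [hsq, hone] at h
  refine mul_left_cancel₀ hq0 ?_
  simp only [jacksonSeq]
  rw [← hone] at h ⊢
  linear_combination h

lemma jacksonSeq_neg_one (hq : ‖q‖ < 1) (hz : ∀ k : ℕ, q * z * q ^ k ≠ 1) :
    jacksonSeq q z (-1) = 1 / qPochInf (q * z) q := by
  rw [← basicHyp_zero_one_self hq hz, jacksonSeq]
  norm_num

lemma one_div_qPochInf (hq : ‖q‖ < 1) (hz : ∀ k : ℕ, q * z * q ^ k ≠ 1) :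
    1 / qPochInf z q = jacksonSeq q z (-1) / (1 - z) := by
  rw [qPochInf_eq_one_sub_mul z hq, jacksonSeq_neg_one hq hz, div_div, mul_comm]

lemma tendsto_jacksonSeq (hq0 : q ≠ 0) (hq : ‖q‖ < 1) (z : ℂ) (k : ℤ) :
    Tendsto (fun n : ℕ => jacksonSeq q z (n + k)) atTop (𝓝 1) := by
  refine (tendsto_basicHyp_nhds_zero (Nat.zero_le _) hq).comp ?_
  have h := (tendsto_pow_atTop_nhds_zero_of_norm_lt_one hq).mul_const (q ^ (k + 2) * z)
  simpa only [add_assoc, zpow_add₀ hq0 (_ : ℕ), zpow_natCast, mul_assoc, zero_mul] using h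

lemma isRogersSzego_zpow_mul_jacksonSeq (hq0 : q ≠ 0) (hq : ‖q‖ < 1) (hz0 : z ≠ 0)
    (hz : ∀ k : ℕ, q * z * q ^ k ≠ 1) : IsRogersSzego q z fun n => z ^ n * jacksonSeq q z n :=
  fun n => by
    simp only [zpow_add₀ hz0, zpow_ofNat]
    linear_combination z ^ n * z * jacksonSeq_recurrence hq0 hq hz n

lemma isRogersSzego_jacksonSeq_inv (hq0 : q ≠ 0) (hq : ‖q‖ < 1) (hz0 : z ≠ 0)
    (hz : ∀ k : ℕ, q * z⁻¹ * q ^ k ≠ 1) : IsRogersSzego q z (jacksonSeq q z⁻¹) := fun n => by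
  linear_combination z * jacksonSeq_recurrence hq0 hq hz n -
    ((1 - q ^ (n + 2)) * jacksonSeq q z⁻¹ (n + 2) - jacksonSeq q z⁻¹ (n + 1)) *
      mul_inv_cancel₀ hz0

lemma jacksonSeq_casoratian (hq0 : q ≠ 0) (hq : ‖q‖ < 1) (hz0 : z ≠ 0)
    (hz : ∀ k : ℕ, q * z * q ^ k ≠ 1) (hz' : ∀ k : ℕ, q * z⁻¹ * q ^ k ≠ 1) :
    z * jacksonSeq q z 0 * jacksonSeq q z⁻¹ (-1) - jacksonSeq q z (-1) * jacksonSeq q z⁻¹ 0 =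
      (z - 1) * qPochInf q q := by
  set W : ℤ → ℂ := fun n => z * jacksonSeq q z (n + 1) * jacksonSeq q z⁻¹ n -
    jacksonSeq q z n * jacksonSeq q z⁻¹ (n + 1) with hW
  have hstep (n : ℤ) : (1 - q ^ (n + 2)) * W (n + 1) = W n := by
    have hJ := jacksonSeq_recurrence hq0 hq hz n
    have hK := isRogersSzego_jacksonSeq_inv hq0 hq hz0 hz' n
    simp only [hW, add_assoc, one_add_one_eq_two]
    linear_combination jacksonSeq q z⁻¹ (n + 1) * hJ - jacksonSeq q z (n + 1) * hK
  have hconst (n : ℕ) : qPoch q q n * W (n + -1) = W (-1) := by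
    induction n with
    | zero => simp [qPoch_zero]
    | succ n ih =>
      have hn := hstep (n + -1)
      rw [show (n + -1 + 2 : ℤ) = (n + 1 : ℕ) by push_cast; ring, zpow_natCast, pow_succ'] at hn
      rw [← ih, qPoch_succ, ← hn, mul_assoc, Nat.cast_succ, add_right_comm]
  have hlim : Tendsto (fun n : ℕ => W (n + -1)) atTop (𝓝 (z * 1 * 1 - 1 * 1)) := by
    have hJ := tendsto_jacksonSeq hq0 hq z
    have hK := tendsto_jacksonSeq hq0 hq z⁻¹
    simp only [hW, add_assoc]
    exact (((hJ _).const_mul z).mul (hK _)).sub ((hJ _).mul (hK _))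
  have h := tendsto_nhds_unique (((tendsto_qPoch q hq).mul hlim).congr hconst)
    tendsto_const_nhds
  simp only [hW, neg_add_cancel] at h
  linear_combination -h

lemma mul_pow_ne_one_of_ne_zpow (hz : ∀ k : ℤ, z ≠ q ^ k) (k : ℕ) : z * q ^ k ≠ 1 := by
  intro h
  refine hz (-k) ?_
  rw [zpow_neg, zpow_natCast]
  exact eq_inv_of_mul_eq_one_left h

lemma self_mul_mul_pow_ne_one_of_ne_zpow (hz : ∀ k : ℤ, z ≠ q ^ k) (k : ℕ) :
    q * z * q ^ k ≠ 1 := by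
  rw [mul_comm q, mul_assoc, ← pow_succ']
  exact mul_pow_ne_one_of_ne_zpow hz (k + 1)

lemma inv_ne_zpow (hz : ∀ k : ℤ, z ≠ q ^ k) (k : ℤ) : z⁻¹ ≠ q ^ k := by
  rw [Ne, inv_eq_iff_eq_inv, ← zpow_neg]
  exact hz (-k)

/-- The combination of the two Jackson solutions of `IsRogersSzego q z` that vanishes at negative
indices and is `1` at `0`; its coefficients are the connection coefficients of the theorem. -/
def connSeq (q z : ℂ) (n : ℤ) : ℂ :=
  1 / (qPochInf z⁻¹ q * qPochInf q q) * (z ^ n * jacksonSeq q z n) +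
    1 / (qPochInf z q * qPochInf q q) * jacksonSeq q z⁻¹ n

lemma isRogersSzego_connSeq (hq0 : q ≠ 0) (hq : ‖q‖ < 1) (hz0 : z ≠ 0)
    (hz : ∀ k : ℤ, z ≠ q ^ k) : IsRogersSzego q z (connSeq q z) :=
  (isRogersSzego_zpow_mul_jacksonSeq hq0 hq hz0
    (self_mul_mul_pow_ne_one_of_ne_zpow hz)).const_mul_add_const_mul
    (isRogersSzego_jacksonSeq_inv hq0 hq hz0
      (self_mul_mul_pow_ne_one_of_ne_zpow (inv_ne_zpow hz))) _ _

lemma connSeq_eq_div (hq : ‖q‖ < 1) (hz0 : z ≠ 0) (hz : ∀ k : ℤ, z ≠ q ^ k) (n : ℤ) :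
    connSeq q z n = (z * jacksonSeq q z⁻¹ (-1) * (z ^ n * jacksonSeq q z n) -
      jacksonSeq q z (-1) * jacksonSeq q z⁻¹ n) / ((z - 1) * qPochInf q q) := by
  have hz1 : z - 1 ≠ 0 := sub_ne_zero.2 (by simpa using hz 0)
  have hz1' : 1 - z ≠ 0 := sub_ne_zero.2 (by simpa using (hz 0).symm)
  have hinv : 1 - z⁻¹ = (z - 1) / z := by field_simp
  rw [connSeq, ← one_div_mul_one_div, ← one_div_mul_one_div,
    one_div_qPochInf hq (self_mul_mul_pow_ne_one_of_ne_zpow hz),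
    one_div_qPochInf hq (self_mul_mul_pow_ne_one_of_ne_zpow (inv_ne_zpow hz)), hinv]
  field_simp
  ring

lemma connSeq_zero (hq0 : q ≠ 0) (hq : ‖q‖ < 1) (hz0 : z ≠ 0) (hz : ∀ k : ℤ, z ≠ q ^ k) :
    connSeq q z 0 = 1 := by
  have hz1 : z - 1 ≠ 0 := sub_ne_zero.2 (by simpa using hz 0)
  rw [connSeq_eq_div hq hz0 hz, div_eq_one_iff_eq
    (mul_ne_zero hz1 (qPochInf_ne_zero hq (self_mul_pow_ne_one hq))),
    ← jacksonSeq_casoratian hq0 hq hz0 (self_mul_mul_pow_ne_one_of_ne_zpow hz)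
      (self_mul_mul_pow_ne_one_of_ne_zpow (inv_ne_zpow hz)), zpow_zero]
  ring

lemma connSeq_of_neg (hq0 : q ≠ 0) (hq : ‖q‖ < 1) (hz0 : z ≠ 0) (hz : ∀ k : ℤ, z ≠ q ^ k)
    {n : ℤ} (hn : n < 0) : connSeq q z n = 0 := by
  refine (isRogersSzego_connSeq hq0 hq hz0 hz).eq_zero_of_neg hz0 ?_ hn
  rw [connSeq_eq_div hq hz0 hz, zpow_neg_one]
  field_simp
  ring

end RogersSzego

section Theta

variable {q x : ℂ}

lemma two_mul_triangle (n : ℤ) : 2 * (n * (n - 1) / 2) = n * (n - 1) :=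
  Int.mul_ediv_cancel' (Int.even_mul_pred_self n).two_dvd

lemma triangle_add (m n : ℤ) :
    (m + n) * (m + n - 1) / 2 = m * (m - 1) / 2 + n * (n - 1) / 2 + m * n := by
  linarith [two_mul_triangle m, two_mul_triangle n, two_mul_triangle (m + n)]

lemma triangle_add_one (n : ℤ) : (n + 1) * (n + 1 - 1) / 2 = n * (n - 1) / 2 + n := by
  simpa using triangle_add n 1

lemma triangle_neg (n : ℤ) : -n * (-n - 1) / 2 = n * (n - 1) / 2 + n := by
  linarith [two_mul_triangle n, two_mul_triangle (-n)]

lemma natCast_triangle (n : ℕ) : ((n * (n - 1) / 2 : ℕ) : ℤ) = n * (n - 1) / 2 := by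
  cases n <;> simp

lemma summable_norm_theta (hq0 : q ≠ 0) (hq : ‖q‖ < 1) (x : ℂ) :
    Summable fun n : ℤ => ‖q ^ (n * (n - 1) / 2) * x ^ n‖ := by
  have hnat (y : ℂ) : Summable fun n : ℕ => ‖q ^ ((n : ℤ) * (n - 1) / 2) * y ^ n‖ := by
    have hpow := (tendsto_pow_atTop_nhds_zero_of_norm_lt_one hq).mul_const y
    refine summable_norm_of_succ_eq_mul (by simp) hpow fun n => ?_
    push_cast
    rw [triangle_add_one, zpow_add₀ hq0, zpow_natCast]
    ring
  refine .of_nat_of_neg (by simpa only [zpow_natCast] using hnat x) ?_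
  refine (hnat (q * x⁻¹)).congr fun n => ?_
  rw [triangle_neg, zpow_add₀ hq0, zpow_neg, zpow_natCast, zpow_natCast, mul_pow, inv_pow,
    mul_assoc]

lemma hasSum_theta (hq0 : q ≠ 0) (hq : ‖q‖ < 1) (x : ℂ) :
    HasSum (fun n : ℤ => q ^ (n * (n - 1) / 2) * x ^ n) (theta q x) :=
  (summable_norm_theta hq0 hq x).of_norm.hasSum

lemma mul_theta_mul (hq0 : q ≠ 0) (hq : ‖q‖ < 1) (hx : x ≠ 0) :
    x * theta q (q * x) = theta q x := by
  have h := (Equiv.addRight (1 : ℤ)).hasSum_iff.2 (hasSum_theta hq0 hq x)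
  refine ((hasSum_theta hq0 hq (q * x)).mul_left x).unique
    (h.congr_fun fun n => ?_)
  simp only [Function.comp, Equiv.coe_addRight]
  rw [triangle_add_one, zpow_add₀ hq0, zpow_add_one₀ hx, mul_zpow]
  ring

lemma theta_neg_one (hq0 : q ≠ 0) (hq : ‖q‖ < 1) : theta q (-1) = 0 := by
  have hsum := hasSum_theta hq0 hq (-1)
  have hodd := ((Equiv.subLeft (1 : ℤ)).hasSum_iff.2 hsum).unique
    (hsum.neg.congr_fun fun n => ?_)
  · exact self_eq_neg.1 hodd
  · simp only [Function.comp, Equiv.subLeft_apply]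
    rw [show (1 - n) * (1 - n - 1) = n * (n - 1) by ring, zpow_sub₀ (by norm_num)]
    rcases Int.even_or_odd n with hn | hn <;> simp [hn.neg_one_zpow]

lemma theta_zpow_mul_eq_zero_iff (hq0 : q ≠ 0) (hq : ‖q‖ < 1) (hx : x ≠ 0) (k : ℤ) :
    theta q (q ^ k * x) = 0 ↔ theta q x = 0 := by
  have hstep (k : ℤ) : theta q (q ^ (k + 1) * x) = 0 ↔ theta q (q ^ k * x) = 0 := by
    have hx' := mul_ne_zero (zpow_ne_zero k hq0) hx
    rw [← mul_theta_mul hq0 hq hx', mul_eq_zero, or_iff_right hx', zpow_add_one₀ hq0,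
      mul_comm (q ^ k), mul_assoc]
  induction k with
  | zero => simp
  | succ n ih => exact (hstep n).trans ih
  | pred n ih =>
    have h := hstep (-n - 1)
    rw [sub_add_cancel] at h
    exact h.symm.trans ih

lemma theta_eq_zero_of_one_div_mem_qSpiral (hq0 : q ≠ 0) (hq : ‖q‖ < 1) {c t : ℂ} (ht : t ≠ 0)
    (h : 1 / t ∈ qSpiral c q) : theta q (-(c * t)) = 0 := by
  obtain ⟨k, hk⟩ := h
  have hct : -(c * t) = q ^ (-k) * -1 := by
    rw [zpow_neg]
    field_simp at hk ⊢
    linear_combination hk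
  rw [hct, theta_zpow_mul_eq_zero_iff hq0 hq (by norm_num), theta_neg_one hq0 hq]

lemma hasSum_theta_mul_basicHyp (hq0 : q ≠ 0) (hq : ‖q‖ < 1) {s : ℂ} (hs : s ≠ 0)
    {as bs : List ℂ} (hlen : (0 :: as).length ≤ bs.length) (x : ℂ) :
    HasSum (fun n : ℤ => q ^ (n * (n - 1) / 2) * s ^ n * basicHyp as bs q (-(s * x * q ^ n)))
      (theta q s * basicHyp (0 :: as) bs q x) := by
  have hprod := hasSum_mul_of_summable_norm (hasSum_theta hq0 hq s) (hasSum_basicHyp hlen hq x)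
    (summable_norm_theta hq0 hq s) (summable_norm_basicHyp hlen hq x)
  let e : ℤ × ℕ ≃ ℤ × ℕ :=
    { toFun := fun i => (i.1 + i.2, i.2)
      invFun := fun i => (i.1 - i.2, i.2)
      left_inv := fun i => by simp
      right_inv := fun i => by simp }
  have hshift : HasSum (fun i : ℤ × ℕ => q ^ ((i.1 + i.2) * (i.1 + i.2 - 1) / 2) *
      s ^ (i.1 + i.2) * (basicHypCoeff (0 :: as) bs q i.2 * x ^ i.2))
      (theta q s * basicHyp (0 :: as) bs q x) := e.hasSum_iff.2 hprod
  refine hshift.prod_fiberwise fun n => ?_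
  have hlen' : as.length ≤ bs.length := (Nat.le_succ _).trans hlen
  refine ((hasSum_basicHyp hlen' hq (-(s * x * q ^ n))).mul_left _).congr_fun fun j => ?_
  rw [triangle_add, zpow_add₀ hq0, zpow_add₀ hq0, zpow_add₀ hs, zpow_natCast, zpow_mul,
    zpow_natCast, ← natCast_triangle, zpow_natCast, basicHypCoeff_zero_cons hq0 as,
    show -(s * x * q ^ n) = -1 * (s * x * q ^ n) by ring, mul_pow, mul_pow, mul_pow]
  have hsign : (-1 : ℂ) ^ j * (-1) ^ j = 1 := by rw [← mul_pow]; norm_num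
  linear_combination -(q ^ (n * (n - 1) / 2) * q ^ (j * (j - 1) / 2) * (q ^ n) ^ j * s ^ n *
    s ^ j * basicHypCoeff (0 :: as) bs q j * x ^ j) * hsign

end Theta

section SolCoeff

variable {q z : ℂ}

/-- The Taylor coefficients of the numerator of the solution at infinity, with `z = q ^ (2 * ν)`;
they are indexed by `ℤ` and vanish at negative indices. -/
def solCoeff (q z : ℂ) (n : ℤ) : ℂ := q ^ (n * (n - 1) / 2) * (-q ^ 2) ^ n * connSeq q z n

lemma solCoeff_zero (hq0 : q ≠ 0) (hq : ‖q‖ < 1) (hz0 : z ≠ 0) (hz : ∀ k : ℤ, z ≠ q ^ k) :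
    solCoeff q z 0 = 1 := by
  simp [solCoeff, connSeq_zero hq0 hq hz0 hz]

lemma solCoeff_of_neg (hq0 : q ≠ 0) (hq : ‖q‖ < 1) (hz0 : z ≠ 0) (hz : ∀ k : ℤ, z ≠ q ^ k)
    {n : ℤ} (hn : n < 0) : solCoeff q z n = 0 := by
  rw [solCoeff, connSeq_of_neg hq0 hq hz0 hz hn, mul_zero]

lemma hasSum_theta_mul_jacksonSeq (hq0 : q ≠ 0) (hq : ‖q‖ < 1) {w t : ℂ} (ht : t ≠ 0) :
    HasSum (fun n : ℤ => q ^ (n * (n - 1) / 2) * (-(q ^ 2 * t)) ^ n * jacksonSeq q w n)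
      (theta q (-(q ^ 2 * t)) * basicHyp [0] [q * w] q (w * t⁻¹)) := by
  have hs : -(q ^ 2 * t) ≠ 0 := neg_ne_zero.2 (mul_ne_zero (pow_ne_zero 2 hq0) ht)
  refine (hasSum_theta_mul_basicHyp hq0 hq hs (as := []) (bs := [q * w]) le_rfl
    (w * t⁻¹)).congr_fun fun n => ?_
  rw [jacksonSeq, zpow_add₀ hq0, zpow_ofNat]
  congr 2
  field_simp

lemma hasSum_solCoeff (hq0 : q ≠ 0) (hq : ‖q‖ < 1) (hz0 : z ≠ 0) (hz : ∀ k : ℤ, z ≠ q ^ k)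
    {t : ℂ} (ht : t ≠ 0) :
    HasSum (fun n : ℕ => solCoeff q z n * t ^ n)
      (1 / (qPochInf z⁻¹ q * qPochInf q q) *
          (theta q (-(q ^ 2 * (z * t))) * basicHyp [0] [q * z] q t⁻¹) +
        1 / (qPochInf z q * qPochInf q q) *
          (theta q (-(q ^ 2 * t)) * basicHyp [0] [q * z⁻¹] q (z⁻¹ * t⁻¹))) := by
  have h₁ := hasSum_theta_mul_jacksonSeq hq0 hq (w := z) (mul_ne_zero hz0 ht)
  have h₂ := hasSum_theta_mul_jacksonSeq hq0 hq (w := z⁻¹) ht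
  rw [mul_inv, mul_inv_cancel_left₀ hz0] at h₁
  have h : HasSum (fun n : ℤ => solCoeff q z n * t ^ n) _ :=
    ((h₁.mul_left (1 / (qPochInf z⁻¹ q * qPochInf q q))).add
      (h₂.mul_left (1 / (qPochInf z q * qPochInf q q)))).congr_fun fun n => by
        rw [show -(q ^ 2 * (z * t)) = -q ^ 2 * (z * t) by ring,
          show -(q ^ 2 * t) = -q ^ 2 * t by ring, mul_zpow, mul_zpow, mul_zpow, solCoeff, connSeq]
        ring
  simpa only [zpow_natCast] using (hasSum_natCast_iff_of_neg_eq_zero fun n hn => by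
    rw [solCoeff_of_neg hq0 hq hz0 hz hn, zero_mul]).2 h

lemma summable_solCoeff (hq0 : q ≠ 0) (hq : ‖q‖ < 1) (hz0 : z ≠ 0) (hz : ∀ k : ℤ, z ≠ q ^ k)
    (t : ℂ) : Summable fun n : ℕ => solCoeff q z n * t ^ n := by
  rcases eq_or_ne t 0 with rfl | ht
  · exact summable_of_ne_finset_zero (s := {0}) fun n hn => by simp [notMem_singleton.1 hn]
  · exact (hasSum_solCoeff hq0 hq hz0 hz ht).summable

lemma neg_one_ne_zpow (hq : ‖q‖ < 1) (k : ℤ) : -1 ≠ q ^ k := by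
  intro h
  have hnorm : ‖q‖ ^ k = 1 := by rw [← norm_zpow, ← h, norm_neg, norm_one]
  rw [zpow_eq_one_iff_right₀ (norm_nonneg q) hq.ne] at hnorm
  rw [hnorm, zpow_zero] at h
  norm_num at h

/- If `theta q` vanished identically, the connection formula at `z = -1` would exhibit the zero
function as a power series with constant term `1`. -/
lemma exists_theta_ne_zero (hq0 : q ≠ 0) (hq : ‖q‖ < 1) : ∃ x ≠ 0, theta q x ≠ 0 := by
  by_contra! htheta
  have hz := neg_one_ne_zpow hq
  have hz0 : (-1 : ℂ) ≠ 0 := by norm_num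
  have hsum : ∀ᶠ t in 𝓝[≠] 0, HasSum (fun n : ℕ => solCoeff q (-1) n * t ^ n) 0 := by
    filter_upwards [eventually_mem_nhdsWithin] with t ht
    have h := hasSum_solCoeff hq0 hq hz0 hz ht
    rw [htheta _ (by simpa [hq0] using ht), htheta _ (by simpa [hq0] using ht)] at h
    simpa using h
  have hzero := congrFun (coeff_eq_zero_of_frequently_eq_zero hsum
    (Eventually.of_forall fun _ => rfl).frequently) 0
  simp [solCoeff_zero hq0 hq hz0 hz] at hzero

lemma frequently_theta_mul_ne_zero (hq0 : q ≠ 0) (hq : ‖q‖ < 1) {c : ℂ} (hc : c ≠ 0) :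
    ∃ᶠ t in 𝓝[≠] 0, theta q (c * t) ≠ 0 := by
  obtain ⟨x, hx, htheta⟩ := exists_theta_ne_zero hq0 hq
  have hlim : Tendsto (fun m : ℕ => q ^ m * (x / c)) atTop (𝓝[≠] 0) := by
    refine tendsto_nhdsWithin_iff.2 ⟨?_, .of_forall fun m => by simp [hq0, hx, hc]⟩
    simpa using (tendsto_pow_atTop_nhds_zero_of_norm_lt_one hq).mul_const (x / c)
  refine hlim.frequently (.of_forall fun m => ?_)
  rwa [mul_left_comm, mul_div_cancel₀ _ hc, ← zpow_natCast, Ne,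
    theta_zpow_mul_eq_zero_iff hq0 hq hx]

end SolCoeff

section Numerator

variable {q z : ℂ} {a b : ℤ → ℂ} {f : ℂ → ℂ} {t : ℂ}

/-- The left-hand side of the `q`-difference equation for the numerator `f` of a function
`f t / theta q (-(q ^ (ν + 2) * t))` solving the Hahn–Exton equation, with `z = q ^ (2 * ν)`. -/
def numeratorOp (q z : ℂ) (f : ℂ → ℂ) (t : ℂ) : ℂ :=
  z * q ^ 5 * t ^ 2 * f (q ^ 2 * t) + (q ^ 2 * (1 + z) * t - 1) * f (q * t) + f t

/-- The coefficient of `t ^ n` in `numeratorOp q z f t` for `f t = ∑ a n * t ^ n`. -/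
def numeratorOpCoeff (q z : ℂ) (a : ℤ → ℂ) (n : ℤ) : ℂ :=
  z * q ^ (2 * n + 1) * a (n - 2) + (1 + z) * q ^ (n + 1) * a (n - 1) + (1 - q ^ n) * a n

lemma hasSum_numeratorOpCoeff (hq0 : q ≠ 0) (ha : ∀ n < 0, a n = 0) (ht : t ≠ 0)
    (h₀ : HasSum (fun n : ℕ => a n * t ^ n) (f t))
    (h₁ : HasSum (fun n : ℕ => a n * (q * t) ^ n) (f (q * t)))
    (h₂ : HasSum (fun n : ℕ => a n * (q ^ 2 * t) ^ n) (f (q ^ 2 * t))) :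
    HasSum (fun n : ℕ => numeratorOpCoeff q z a n * t ^ n) (numeratorOp q z f t) := by
  have hint {s y : ℂ} (h : HasSum (fun n : ℕ => a n * s ^ n) y) :
      HasSum (fun n : ℤ => a n * s ^ n) y :=
    (hasSum_natCast_iff_of_neg_eq_zero fun n hn => by rw [ha n hn, zero_mul]).1 <| by
      simpa only [zpow_natCast] using h
  have hshift₁ := (Equiv.subRight (1 : ℤ)).hasSum_iff.2 (hint h₁)
  have hshift₂ := (Equiv.subRight (2 : ℤ)).hasSum_iff.2 (hint h₂)
  have h : HasSum (fun n : ℤ => numeratorOpCoeff q z a n * t ^ n) _ :=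
    (((hshift₂.mul_left (z * q ^ 5 * t ^ 2)).add
      ((hshift₁.mul_left (q ^ 2 * (1 + z) * t)).sub (hint h₁))).add (hint h₀)).congr_fun
      fun n => by
        have hq2 : (q ^ 2) ^ n = (q ^ n) ^ 2 := by rw [← zpow_natCast, zpow_comm, zpow_natCast]
        simp only [Function.comp, Equiv.subRight_apply, numeratorOpCoeff, mul_zpow,
          zpow_sub₀ hq0, zpow_sub₀ (pow_ne_zero 2 hq0), zpow_sub₀ ht, zpow_add₀ hq0, zpow_mul' q,
          zpow_ofNat, hq2]
        field_simp
        ring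
  have hop : numeratorOp q z f t = z * q ^ 5 * t ^ 2 * f (q ^ 2 * t) +
      (q ^ 2 * (1 + z) * t * f (q * t) - f (q * t)) + f t := by
    rw [numeratorOp]
    ring
  rw [hop]
  simpa only [zpow_natCast] using (hasSum_natCast_iff_of_neg_eq_zero fun n hn => by
    simp [numeratorOpCoeff, ha n hn, ha (n - 1) (by lia), ha (n - 2) (by lia)]).2 h

lemma eq_of_numeratorOpCoeff_eq_zero (hq : ‖q‖ < 1) (ha : ∀ n < 0, a n = 0)
    (hb : ∀ n < 0, b n = 0) (h0 : a 0 = b 0) (hopa : ∀ n : ℕ, numeratorOpCoeff q z a n = 0)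
    (hopb : ∀ n : ℕ, numeratorOpCoeff q z b n = 0) (n : ℕ) : a n = b n := by
  suffices a n = b n ∧ a (n - 1) = b (n - 1) from this.1
  induction n with
  | zero => exact ⟨by simpa using h0, by rw [ha _ (by simp), hb _ (by simp)]⟩
  | succ n ih =>
    have hn : 1 - q ^ (n + 1) ≠ 0 := by
      rw [pow_succ', sub_ne_zero]
      exact (self_mul_pow_ne_one hq n).symm
    have hrec := (hopa (n + 1)).trans (hopb (n + 1)).symm
    simp only [numeratorOpCoeff] at hrec
    rw [show ((n + 1 : ℕ) - 2 : ℤ) = n - 1 by push_cast; ring,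
      show ((n + 1 : ℕ) - 1 : ℤ) = n by push_cast; ring, ih.1, ih.2, zpow_natCast] at hrec
    refine ⟨mul_left_cancel₀ hn (add_left_cancel hrec), ?_⟩
    simpa using ih.1

lemma IsRogersSzego.numeratorOpCoeff_eq_zero (hq0 : q ≠ 0) (ha : IsRogersSzego q z a) (n : ℤ) :
    numeratorOpCoeff q z (fun n => q ^ (n * (n - 1) / 2) * (-q ^ 2) ^ n * a n) n = 0 := by
  obtain ⟨m, rfl⟩ : ∃ m, n = m + 2 := ⟨n - 2, by ring⟩
  have hs : -q ^ 2 ≠ 0 := by simp [hq0]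
  have htri : (m + 2) * (m + 2 - 1) / 2 = m * (m - 1) / 2 + (m + (m + 1)) := by
    rw [triangle_add]
    norm_num
    ring
  have hrec := ha m
  rw [numeratorOpCoeff, htri, add_sub_cancel_right, show m + 2 - 1 = m + 1 by ring,
    triangle_add_one]
  simp only [zpow_add₀ hq0, zpow_add₀ hs, mul_add, zpow_mul' q, zpow_ofNat] at hrec ⊢
  linear_combination q ^ (m * (m - 1) / 2) * (-q ^ 2) ^ m * (q ^ m) ^ 2 * q ^ 5 * hrec

lemma numeratorOpCoeff_solCoeff (hq0 : q ≠ 0) (hq : ‖q‖ < 1) (hz0 : z ≠ 0)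
    (hz : ∀ k : ℤ, z ≠ q ^ k) (n : ℤ) : numeratorOpCoeff q z (solCoeff q z) n = 0 :=
  (isRogersSzego_connSeq hq0 hq hz0 hz).numeratorOpCoeff_eq_zero hq0 n

end Numerator

section Solution

variable {p ν t : ℂ} {a : ℕ → ℂ}

lemma cpow_add_two (hp0 : p ≠ 0) (ν : ℂ) : p ^ (ν + 2) = p ^ 2 * p ^ ν := by
  rw [Complex.cpow_add _ _ hp0, Complex.cpow_ofNat, mul_comm]

lemma inv_theta_mul (hp0 : p ≠ 0) (hp1 : ‖p‖ < 1) {x : ℂ} (hx : x ≠ 0) :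
    (theta p (p * x))⁻¹ = x * (theta p x)⁻¹ := by
  rw [← mul_theta_mul hp0 hp1 hx, mul_inv, mul_inv_cancel_left₀ hx]

lemma hahnExtonEqAt_zFun_iff (hp0 : p ≠ 0) (hp1 : ‖p‖ < 1) (ht : t ≠ 0) :
    HahnExtonEqAt p ν (zFun p ν a) t ↔ theta p (-(p ^ (ν + 2) * t)) = 0 ∨
      numeratorOp p (p ^ (2 * ν)) (fun t => ∑' n, a n * t ^ n) t = 0 := by
  have hc : p ^ ν ≠ 0 := by simp [Complex.cpow_eq_zero_iff, hp0]
  have hx : -(p ^ (ν + 2) * t) ≠ 0 := by simp [Complex.cpow_eq_zero_iff, hp0, ht]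
  have htheta₁ : (theta p (-(p ^ (ν + 2) * (p * t))))⁻¹ =
      -(p ^ (ν + 2) * t) * (theta p (-(p ^ (ν + 2) * t)))⁻¹ := by
    rw [← inv_theta_mul hp0 hp1 hx]
    ring_nf
  have htheta₂ : (theta p (-(p ^ (ν + 2) * (p ^ 2 * t))))⁻¹ =
      p * -(p ^ (ν + 2) * t) * (theta p (-(p ^ (ν + 2) * (p * t))))⁻¹ := by
    rw [show -(p ^ (ν + 2) * (p * t)) = p * -(p ^ (ν + 2) * t) by ring,
      ← inv_theta_mul hp0 hp1 (mul_ne_zero hp0 hx)]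
    ring_nf
  rw [← inv_eq_zero, ← mul_eq_zero, HahnExtonEqAt]
  refine Eq.congr_left ?_
  simp only [zFun, numeratorOp, htheta₂, htheta₁]
  rw [show -2 - ν = -(ν + 2) by ring, Complex.cpow_neg, Complex.cpow_neg, cpow_add_two hp0,
    Complex.cpow_ofNat_mul]
  field_simp
  ring

lemma IsSolutionAtInfinity.numeratorOpCoeff_eq_zero (hp0 : p ≠ 0) (hp1 : ‖p‖ < 1) {a : ℤ → ℂ}
    (ha : ∀ n < 0, a n = 0) (h : IsSolutionAtInfinity p ν fun n => a n) (n : ℕ) :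
    numeratorOpCoeff p (p ^ (2 * ν)) a n = 0 := by
  obtain ⟨-, r, hr, hsum, heq⟩ := h
  have hc : -p ^ (ν + 2) ≠ 0 := by simp [Complex.cpow_eq_zero_iff, hp0]
  have hball : ∀ᶠ t : ℂ in 𝓝[≠] 0, ‖t‖ < r :=
    eventually_nhdsWithin_of_eventually_nhds (eventually_norm_sub_lt 0 hr |>.mono (by simp))
  have hlt {t : ℂ} (ht : ‖t‖ < r) : ‖p * t‖ < r := by
    rw [norm_mul]
    exact (mul_le_of_le_one_left (norm_nonneg t) hp1.le).trans_lt ht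
  refine congrFun (coeff_eq_zero_of_frequently_eq_zero
    (b := fun n : ℕ => numeratorOpCoeff p (p ^ (2 * ν)) a n)
    (F := numeratorOp p (p ^ (2 * ν)) fun t => ∑' n : ℕ, a n * t ^ n) ?_ ?_) n
  · filter_upwards [hball, eventually_mem_nhdsWithin] with t ht ht0
    refine hasSum_numeratorOpCoeff hp0 ha ht0 (hsum t ht).hasSum (hsum _ (hlt ht)).hasSum
      (hsum _ ?_).hasSum
    rw [sq, mul_assoc]
    exact hlt (hlt ht)
  · refine ((frequently_theta_mul_ne_zero hp0 hp1 hc).and_eventually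
      (hball.and eventually_mem_nhdsWithin)).mono fun t ⟨htheta, ht, ht0⟩ => ?_
    rw [neg_mul] at htheta
    exact ((hahnExtonEqAt_zFun_iff hp0 hp1 ht0).1 (heq t ht0 ht
      (mt (theta_eq_zero_of_one_div_mem_qSpiral hp0 hp1 ht0) htheta))).resolve_left htheta

lemma isSolutionAtInfinity_solCoeff (hp0 : p ≠ 0) (hp1 : ‖p‖ < 1)
    (hν : ∀ k : ℤ, p ^ (2 * ν) ≠ p ^ k) :
    IsSolutionAtInfinity p ν fun n => solCoeff p (p ^ (2 * ν)) n := by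
  have hz0 : p ^ (2 * ν) ≠ 0 := by simp [Complex.cpow_eq_zero_iff, hp0]
  have hsum := summable_solCoeff hp0 hp1 hz0 hν
  refine ⟨by simpa using solCoeff_zero hp0 hp1 hz0 hν, 1, one_pos, fun t _ => hsum t,
    fun t ht _ _ => (hahnExtonEqAt_zFun_iff hp0 hp1 ht).2 (.inr ?_)⟩
  have h := hasSum_numeratorOpCoeff (z := p ^ (2 * ν)) hp0
    (fun n hn => solCoeff_of_neg hp0 hp1 hz0 hν hn) ht
    (f := fun t => ∑' n : ℕ, solCoeff p (p ^ (2 * ν)) n * t ^ n)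
    (hsum _).hasSum (hsum _).hasSum (hsum _).hasSum
  refine h.unique (hasSum_zero.congr_fun fun n => ?_)
  rw [numeratorOpCoeff_solCoeff hp0 hp1 hz0 hν, zero_mul]

lemma isSolutionAtInfinity_iff (hp0 : p ≠ 0) (hp1 : ‖p‖ < 1)
    (hν : ∀ k : ℤ, p ^ (2 * ν) ≠ p ^ k) :
    IsSolutionAtInfinity p ν a ↔ a = fun n : ℕ => solCoeff p (p ^ (2 * ν)) n := by
  have hsol := isSolutionAtInfinity_solCoeff hp0 hp1 hν
  refine ⟨fun ha => funext fun n => ?_, fun h => h ▸ hsol⟩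
  have hz0 : p ^ (2 * ν) ≠ 0 := by simp [Complex.cpow_eq_zero_iff, hp0]
  have hneg (n : ℤ) (hn : n < 0) := solCoeff_of_neg hp0 hp1 hz0 hν hn
  obtain ⟨A, rfl, hA⟩ : ∃ A : ℤ → ℂ, (fun n : ℕ => A n) = a ∧ ∀ n < 0, A n = 0 :=
    ⟨Function.extend Nat.cast a 0, funext fun n => Nat.cast_injective.extend_apply a 0 n,
      fun n hn => Function.extend_apply' _ _ _ fun ⟨m, hm⟩ => by lia⟩
  exact eq_of_numeratorOpCoeff_eq_zero hp1 hA hneg (ha.1.trans hsol.1.symm)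
    (ha.numeratorOpCoeff_eq_zero hp0 hp1 hA) (hsol.numeratorOpCoeff_eq_zero hp0 hp1 hneg) n

end Solution

end HahnExton

end

theorem theorem1 (p ν : ℂ) (hp0 : p ≠ 0) (hp1 : ‖p‖ < 1)
    (hν : ∀ k : ℤ, p ^ (2 * ν) ≠ p ^ k) :
    (∃! a : ℕ → ℂ, HahnExton.IsSolutionAtInfinity p ν a) ∧
    ∀ a : ℕ → ℂ, HahnExton.IsSolutionAtInfinity p ν a →
      (∀ t : ℂ, Summable fun n : ℕ => a n * t ^ n) ∧
      ∀ x : ℂ, x ≠ 0 → x ∉ HahnExton.qSpiral (p ^ (ν + 2)) p →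
        HahnExton.zFun p ν a (1 / x) =
          1 / (HahnExton.qPochInf (p ^ (-2 * ν)) p * HahnExton.qPochInf p p) *
              (HahnExton.theta p (-(p ^ (2 * ν + 2) / x)) /
                HahnExton.theta p (-(p ^ (ν + 2) / x))) *
              HahnExton.basicHyp [0] [p ^ (1 + 2 * ν)] p x +
          1 / (HahnExton.qPochInf (p ^ (2 * ν)) p * HahnExton.qPochInf p p) *
              (HahnExton.theta p (-(p ^ 2 / x)) /
                HahnExton.theta p (-(p ^ (ν + 2) / x))) *
              HahnExton.basicHyp [0] [p ^ (1 - 2 * ν)] p (p ^ (-2 * ν) * x) := by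
  have hz0 : p ^ (2 * ν) ≠ 0 := by simp [Complex.cpow_eq_zero_iff, hp0]
  simp only [HahnExton.isSolutionAtInfinity_iff hp0 hp1 hν, existsUnique_eq, forall_eq, true_and]
  refine ⟨HahnExton.summable_solCoeff hp0 hp1 hz0 hν, fun x hx _ => ?_⟩
  have hsum := (HahnExton.hasSum_solCoeff hp0 hp1 hz0 hν (one_div_ne_zero hx)).tsum_eq
  have hadd : p ^ (1 + 2 * ν) = p * p ^ (2 * ν) := by
    rw [Complex.cpow_add _ _ hp0, Complex.cpow_one]
  have hsub : p ^ (1 - 2 * ν) = p * (p ^ (2 * ν))⁻¹ := by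
    rw [Complex.cpow_sub _ _ hp0, Complex.cpow_one, div_eq_mul_inv]
  rw [HahnExton.zFun, hsum, one_div x, inv_inv, HahnExton.cpow_add_two hp0 (2 * ν), hadd, hsub,
    neg_mul, Complex.cpow_neg]
  simp only [div_eq_mul_inv, mul_assoc]
  ring
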